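/- Let $k,l,m\ge 2$ be integers and let $r\in(\mathbb Z/\mathrm{lcm}(k,l,m)\mathbb Z)^{*}$ be a unit. Write $\sim$ for conjugacy in a group. A group $G$ is called $(k,l,m,r)$-quasi-Burnside if for all $x,y,z\in G$ with $xy=z$ and $x^k=y^l=z^m=1$ there exist $x',y',z'\in G$ with $x'y'=z'$, $x'\sim x^r$, $y'\sim y^r$ and $z'\sim z^r$ (the powers $x^r,y^r,z^r$ are taken with any integer representing $r$; they do not depend on the choice). Then the following are equivalent: 1. Every group is $(k,l,m,r)$-quasi-Burnside. 2. The group $\mathrm{PSL}_2(\mathbb R)=\mathrm{SL}_2(\mathbb R)/\{\pm \mathrm I\}$ is $(k,l,m,r)$-quasi-Burnside. 3. $\frac1k+\frac1l+\frac1m\ge 1$ or $r\in\{1,-1\}$. -/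

import Mathlib

universe u

/-- A group `G` is `(k,l,m,r)`-quasi-Burnside. For `g` with `g ^ lcm(k,l,m) = 1` the power `g ^ r`
with `r` a class modulo `lcm(k,l,m)` is `g ^ n` for any integer representative `n` of `r`; here the
representative `r.val` is taken (see `pow_val_eq_zpow`). -/
def IsQuasiBurnside (k l m : ℕ) (r : (ZMod ((k.lcm l).lcm m))ˣ)
    (G : Type*) [Group G] : Prop :=
  ∀ x y z : G, x * y = z → x ^ k = 1 → y ^ l = 1 → z ^ m = 1 →
    ∃ x' y' z' : G, x' * y' = z' ∧
      IsConj x' (x ^ (r : ZMod ((k.lcm l).lcm m)).val) ∧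
      IsConj y' (y ^ (r : ZMod ((k.lcm l).lcm m)).val) ∧
      IsConj z' (z ^ (r : ZMod ((k.lcm l).lcm m)).val)

/-- The power `g ^ r` does not depend on the integer that represents the residue class `r`. -/
theorem pow_val_eq_zpow {G : Type*} [Group G] {N : ℕ} [NeZero N] (r : ZMod N) (g : G)
    (hg : g ^ N = 1) (n : ℤ) (hn : (n : ZMod N) = r) : g ^ r.val = g ^ n := by
  subst hn
  rw [← zpow_natCast, ZMod.val_intCast]
  conv_rhs => rw [← Int.emod_add_mul_ediv n N]
  rw [zpow_add, zpow_mul, zpow_natCast g N, hg, one_zpow, mul_one]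

/-! The class `r` is replaced by its representative `n`, coprime to `k`, `l`, `m`. Exponent `1` is
harmless in every group, and so is `-1`, because `(xy)⁻¹ = x⁻¹ · (x y⁻¹ x⁻¹)`.

If `1/k + 1/l + 1/m ≥ 1`, the sorted triples are `(2,2,m)`, `(2,3,3)` to `(2,3,6)`, `(2,4,4)` and
`(3,3,3)`. In all but the dihedral, octahedral and icosahedral cases `n` is `±1` modulo all three
orders; those three cases follow from explicit words.

If the sum is less than `1`, hyperbolic triangles detect `n`. In `PSL₂(ℝ)`, rotations with
half-angles `s, t, u` in `(0, π)` and product one satisfy `s + t + u ≤ π` or `s + t + u ≥ 2π`, by a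
trace inequality in `SL₂(ℝ)`; conversely every triple of sum at most `π` occurs. Hence
multiplication by `n` on the angles `πa/k, πb/l, πc/m` respects this region (`AngleStable`). With
`a, b` fixed, the admissible `c` form an initial segment, and a unit that preserves a proper initial
segment of residues is `1`. So `n` is `1` modulo each order, or `-1` modulo each. -/

/-- The quasi-Burnside property for a natural exponent `n`, with the product `z` eliminated. -/
def IsPowBurnside (k l m n : ℕ) (G : Type*) [Group G] : Prop :=
  ∀ x y : G, x ^ k = 1 → y ^ l = 1 → (x * y) ^ m = 1 →
    ∃ x' y' : G, IsConj x' (x ^ n) ∧ IsConj y' (y ^ n) ∧ IsConj (x' * y') ((x * y) ^ n)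

/-! ### Spherical and Euclidean triples: identities valid in every group. -/

section PowBurnside

variable {G : Type*} [Group G]

theorem isConj_inv_of_isConj {a b : G} (h : IsConj a b) : IsConj a⁻¹ b⁻¹ := by
  obtain ⟨c, rfl⟩ := isConj_iff.1 h
  exact isConj_iff.2 ⟨c, by group⟩

theorem isConj_conj (a c : G) : IsConj (c * a * c⁻¹) a :=
  (isConj_iff.2 ⟨c, rfl⟩ : IsConj a (c * a * c⁻¹)).symm

/-- Uses `xy = y · (y⁻¹xy)`. With `rotate` below, it makes the property symmetric in the three
orders, so they may be sorted. -/
theorem IsPowBurnside.swap {k l m n : ℕ} (h : IsPowBurnside k l m n G) :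
    IsPowBurnside l k m n G := by
  intro x y hx hy hz
  have hc : y⁻¹ * x * y = y⁻¹ * x * y⁻¹⁻¹ := by rw [inv_inv]
  have hp : y * (y⁻¹ * x * y) = x * y := by group
  obtain ⟨a, b, ha, hb, hab⟩ := h y (y⁻¹ * x * y) hy
    (by rw [hc, conj_pow, hx]; simp) (by rw [hp, hz])
  refine ⟨a * b * a⁻¹, a, (isConj_conj b a).trans (hb.trans ?_), ha, ?_⟩
  · rw [hc]
    exact (isConj_conj x y⁻¹).pow n
  · rw [hp] at hab
    simpa using hab

theorem IsPowBurnside.rotate {k l m n : ℕ} (h : IsPowBurnside k l m n G) :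
    IsPowBurnside l m k n G := by
  intro x y hx hy hz
  have hp : (x * y)⁻¹ * x = y⁻¹ := by group
  obtain ⟨a, b, ha, hb, hab⟩ := h (x * y)⁻¹ x (by rw [inv_pow, hz, inv_one]) hx
    (by rw [hp, inv_pow, hy, inv_one])
  refine ⟨b, (a * b)⁻¹, hb, ?_, ?_⟩
  · simpa [hp] using isConj_inv_of_isConj hab
  · have := isConj_inv_of_isConj ha
    rw [inv_pow, inv_inv] at this
    simpa only [mul_inv_rev, mul_inv_cancel_left] using this

theorem pow_eq_pow_of_mod_eq {g : G} {k n n' : ℕ} (hg : g ^ k = 1) (hn : n % k = n' % k) :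
    g ^ n = g ^ n' := by
  rw [← Nat.mod_add_div n k, ← Nat.mod_add_div n' k, pow_add, pow_add, pow_mul, pow_mul, hg, hn,
    one_pow, one_pow]

theorem pow_eq_inv_of_dvd_succ {g : G} {k n : ℕ} (hg : g ^ k = 1) (hn : k ∣ n + 1) :
    g ^ n = g⁻¹ := by
  obtain ⟨c, hc⟩ := hn
  rw [eq_inv_iff_mul_eq_one, ← pow_succ, hc, pow_mul, hg, one_pow]

theorem isPowBurnside_of_mod_eq_one {k l m n : ℕ} (hk : n % k = 1 % k) (hl : n % l = 1 % l)
    (hm : n % m = 1 % m) : IsPowBurnside k l m n G := by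
  intro x y hx hy hz
  rw [pow_eq_pow_of_mod_eq hx hk, pow_eq_pow_of_mod_eq hy hl, pow_eq_pow_of_mod_eq hz hm]
  simp only [pow_one]
  exact ⟨x, y, .refl _, .refl _, .refl _⟩

theorem isPowBurnside_of_dvd_succ {k l m n : ℕ} (hk : k ∣ n + 1) (hl : l ∣ n + 1)
    (hm : m ∣ n + 1) : IsPowBurnside k l m n G := by
  intro x y hx hy hz
  rw [pow_eq_inv_of_dvd_succ hx hk, pow_eq_inv_of_dvd_succ hy hl, pow_eq_inv_of_dvd_succ hz hm]
  refine ⟨x⁻¹, x * y⁻¹ * x⁻¹, .refl _, isConj_conj _ _, ?_⟩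
  rw [show x⁻¹ * (x * y⁻¹ * x⁻¹) = (x * y)⁻¹ by group]

/-- Put `z = xy` and `n = 2s + 1`. Since `x` inverts `z`, `x · (z⁻ˢ y zˢ) = zˢ (xy) zˢ = zⁿ`. -/
theorem isPowBurnside_dihedral {m n : ℕ} (hn : n % 2 = 1) : IsPowBurnside 2 2 m n G := by
  intro x y hx hy _
  obtain ⟨s, rfl⟩ : ∃ s, n = 2 * s + 1 := ⟨n / 2, by omega⟩
  have hxi : x⁻¹ = x := by rw [inv_eq_iff_mul_eq_one, ← sq, hx]
  have hyi : y⁻¹ = y := by rw [inv_eq_iff_mul_eq_one, ← sq, hy]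
  have hinv : x * (x * y) * x⁻¹ = (x * y)⁻¹ := by
    rw [mul_inv_rev, hxi, hyi, ← mul_assoc, ← sq, hx, one_mul]
  have hs : x * (x * y) ^ s = ((x * y) ^ s)⁻¹ * x := by
    rw [← inv_pow, ← hinv, conj_pow]
    group
  refine ⟨x, ((x * y) ^ s)⁻¹ * y * ((x * y) ^ s)⁻¹⁻¹, ?_, ?_, ?_⟩
  · rw [pow_succ, pow_mul, hx, one_pow, one_mul]
  · rw [pow_succ, pow_mul, hy, one_pow, one_mul]
    exact isConj_conj _ _
  · have hs' : x * ((x * y) ^ s)⁻¹ = (x * y) ^ s * x := by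
      have := congrArg (fun t => x⁻¹ * t * x⁻¹) hs
      simp only [inv_mul_cancel_left, mul_assoc, mul_inv_cancel, mul_one] at this
      rw [hxi] at this
      exact this.symm
    rw [inv_inv, show x * (((x * y) ^ s)⁻¹ * y * (x * y) ^ s) =
      x * ((x * y) ^ s)⁻¹ * y * (x * y) ^ s by group, hs', mul_assoc _ x y, ← pow_succ, ← pow_add,
      show s + 1 + s = 2 * s + 1 by ring]

/-- Rewriting rules for words in `x`, `y`, `y⁻¹`; the forms with a tail `t` act inside
right-associated products. -/
theorem words_of_sq_cube {x y : G} (hx : x ^ 2 = 1) (hy : y ^ 3 = 1) :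
    x⁻¹ = x ∧ x * x = 1 ∧ (∀ t, x * (x * t) = t) ∧ y⁻¹ * y⁻¹ = y ∧ y * y = y⁻¹ ∧
      (∀ t, y⁻¹ * (y⁻¹ * t) = y * t) ∧ ∀ t, y * (y * t) = y⁻¹ * t := by
  have h1 : x * x = 1 := by rw [← sq, hx]
  have h5 : y * y = y⁻¹ := by rw [eq_inv_iff_mul_eq_one, ← hy, pow_succ, sq]
  have h4 : y⁻¹ * y⁻¹ = y := by rw [← mul_inv_rev, h5, inv_inv]
  exact ⟨inv_eq_of_mul_eq_one_left h1, h1, fun t => by rw [← mul_assoc, h1, one_mul], h4, h5,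
    fun t => by rw [← mul_assoc, h4], fun t => by rw [← mul_assoc, h5]⟩

/-- In a quotient of the octahedral group the element of order three is conjugate to its inverse. -/
theorem isConj_inv_cube_of_octahedral {x y : G} (hx : x ^ 2 = 1) (hy : y ^ 3 = 1)
    (hz : (x * y) ^ 4 = 1) : IsConj y y⁻¹ := by
  obtain ⟨hxi, h1, r1, h4, h5, r4, r5⟩ := words_of_sq_cube hx hy
  -- The relation `(xy)⁴ = 1`, split in half as `(xy)² = (xy)⁻²`.
  have r6 : ∀ t, x * (y * (x * (y * t))) = y⁻¹ * (x * (y⁻¹ * (x * t))) := fun t => by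
    have : (x * y) ^ 2 = ((x * y) ^ 2)⁻¹ := by rw [eq_inv_iff_mul_eq_one, ← pow_add, hz]
    simpa only [sq, mul_inv_rev, hxi, mul_assoc] using congrArg (· * t) this
  refine isConj_iff.2 ⟨x * y * x * y⁻¹ * x, ?_⟩
  simp only [mul_inv_rev, inv_inv, hxi, mul_assoc, r1, r4, r6, h1, mul_one, mul_inv_cancel_left]

/-- The ten letters of `(xy)⁵ = 1` are cut into two halves of five. -/
theorem word_of_icosahedral {x y : G} (hx : x ^ 2 = 1) (hy : y ^ 3 = 1)
    (hz : (x * y) ^ 5 = 1) :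
    x * (y * (x * (y * x))) = y⁻¹ * (x * (y⁻¹ * (x * y⁻¹))) := by
  obtain ⟨hxi, -⟩ := words_of_sq_cube hx hy
  have : x * (y * (x * (y * x))) = (y * (x * (y * (x * y))))⁻¹ := by
    rw [eq_inv_iff_mul_eq_one, ← hz]
    simp only [pow_succ, pow_zero, one_mul, mul_assoc]
  simpa only [mul_inv_rev, hxi, mul_assoc] using this

/-- In a quotient of the icosahedral group the element of order three is conjugate to its
inverse. -/
theorem isConj_inv_cube_of_icosahedral {x y : G} (hx : x ^ 2 = 1) (hy : y ^ 3 = 1)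
    (hz : (x * y) ^ 5 = 1) : IsConj y y⁻¹ := by
  have h6 := word_of_icosahedral hx hy hz
  obtain ⟨hxi, h1, r1, h4, h5, r4, r5⟩ := words_of_sq_cube hx hy
  have r6 : ∀ t, x * (y * (x * (y * (x * t)))) = y⁻¹ * (x * (y⁻¹ * (x * (y⁻¹ * t)))) :=
    fun t => by simpa only [mul_assoc] using congrArg (· * t) h6
  refine isConj_iff.2 ⟨x * y * x * y⁻¹ * x * y * x * y⁻¹ * x, ?_⟩
  simp only [mul_inv_rev, inv_inv, hxi, mul_assoc, r1, r4, r6, h6, mul_inv_cancel_left,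
    inv_mul_cancel_left]

/-- In a quotient of the icosahedral group the element of order five is conjugate to its
inverse. -/
theorem isConj_inv_mul_of_icosahedral {x y : G} (hx : x ^ 2 = 1) (hy : y ^ 3 = 1)
    (hz : (x * y) ^ 5 = 1) : IsConj (x * y) (x * y)⁻¹ := by
  have h6 := (word_of_icosahedral hx hy hz).symm
  obtain ⟨hxi, h1, r1, h4, h5, r4, r5⟩ := words_of_sq_cube hx hy
  have r6 : ∀ t, y⁻¹ * (x * (y⁻¹ * (x * (y⁻¹ * t)))) = x * (y * (x * (y * (x * t)))) :=
    fun t => by simpa only [mul_assoc] using congrArg (· * t) h6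
  refine isConj_iff.2 ⟨y * x * y * x * y⁻¹ * x * y⁻¹, ?_⟩
  simp only [mul_inv_rev, inv_inv, hxi, mul_assoc, r1, r5, r6, h6, mul_inv_cancel_left]

theorem mod_two_of_coprime {n : ℕ} (h : n.Coprime 2) : n % 2 = 1 :=
  Nat.odd_iff.1 (Nat.coprime_two_right.1 h)

theorem mod_three_of_coprime {n : ℕ} (h : n.Coprime 3) : n % 3 = 1 ∨ n % 3 = 2 := by
  have := Nat.prime_three.coprime_iff_not_dvd.1 h.symm
  omega

theorem isPowBurnside_octahedral {n : ℕ} (h2 : n.Coprime 2) (h3 : n.Coprime 3) :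
    IsPowBurnside 2 3 4 n G := by
  intro x y hx hy hz
  have h2 := mod_two_of_coprime h2
  have hyn : IsConj y (y ^ n) := by
    rcases mod_three_of_coprime h3 with h | h
    · rw [pow_eq_pow_of_mod_eq hy (n' := 1) h, pow_one]
    · rw [pow_eq_inv_of_dvd_succ hy (by omega)]
      exact isConj_inv_cube_of_octahedral hx hy hz
  rcases (by omega : n % 4 = 1 ∨ n % 4 = 3) with h | h
  · refine ⟨x, y, ?_, hyn, ?_⟩
    · rw [pow_eq_pow_of_mod_eq hx (n' := 1) h2, pow_one]
    · rw [pow_eq_pow_of_mod_eq hz (n' := 1) h, pow_one]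
  · refine ⟨x⁻¹, x * y⁻¹ * x⁻¹, ?_, ?_, ?_⟩
    · rw [pow_eq_inv_of_dvd_succ hx (by omega)]
    · exact (isConj_conj _ _).trans ((isConj_inv_cube_of_octahedral hx hy hz).symm.trans hyn)
    · rw [pow_eq_inv_of_dvd_succ hz (by omega),
        show x⁻¹ * (x * y⁻¹ * x⁻¹) = (x * y)⁻¹ by group]

theorem isPowBurnside_icosahedral {n : ℕ} (h2 : n.Coprime 2) (h3 : n.Coprime 3)
    (h5 : n.Coprime 5) : IsPowBurnside 2 3 5 n G := by
  intro x y hx hy hz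
  have h2 := mod_two_of_coprime h2
  have hxn : x ^ n = x := by rw [pow_eq_pow_of_mod_eq hx (n' := 1) h2, pow_one]
  have hyn : IsConj y (y ^ n) := by
    rcases mod_three_of_coprime h3 with h | h
    · rw [pow_eq_pow_of_mod_eq hy (n' := 1) h, pow_one]
    · rw [pow_eq_inv_of_dvd_succ hy (by omega)]
      exact isConj_inv_cube_of_icosahedral hx hy hz
  have hzi := isConj_inv_mul_of_icosahedral hx hy hz
  -- As `xy` is conjugate to its inverse, only the exponents `1` and `2` modulo `5` remain.
  have hzn : IsConj (x * y) ((x * y) ^ n) ∨ IsConj ((x * y) ^ 2) ((x * y) ^ n) := by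
    rcases (by have := (Nat.prime_five.coprime_iff_not_dvd).1 h5.symm; omega :
      n % 5 = 1 ∨ n % 5 = 2 ∨ n % 5 = 3 ∨ n % 5 = 4) with h | h | h | h
    · rw [pow_eq_pow_of_mod_eq hz (n' := 1) h, pow_one]
      exact .inl (.refl _)
    · rw [pow_eq_pow_of_mod_eq hz (n' := 2) h]
      exact .inr (.refl _)
    · rw [pow_eq_pow_of_mod_eq hz (n' := 3) h, show (x * y) ^ 3 = (x * y)⁻¹ ^ 2 by
        rw [inv_pow, eq_inv_iff_mul_eq_one, ← pow_add, hz]]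
      exact .inr (hzi.pow 2)
    · rw [pow_eq_inv_of_dvd_succ hz (by omega)]
      exact .inl hzi
  rcases hzn with hzn | hzn
  · exact ⟨x, y, hxn.symm ▸ .refl x, hyn, hzn⟩
  · have h6 := word_of_icosahedral hx hy hz
    obtain ⟨hxi, h1, r1, h4, h5, r4, r5⟩ := words_of_sq_cube hx hy
    have r6 : ∀ t, x * (y * (x * (y * (x * t)))) = y⁻¹ * (x * (y⁻¹ * (x * (y⁻¹ * t)))) :=
      fun t => by simpa only [mul_assoc] using congrArg (· * t) h6
    -- This conjugate of `y` is chosen so that its product with `x` is `y⁻¹ (xy)² y`.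
    refine ⟨x, (y * x * y * x) * y * (y * x * y * x)⁻¹, hxn.symm ▸ .refl x,
      (isConj_conj _ _).trans hyn, IsConj.trans ?_ hzn⟩
    have : x * ((y * x * y * x) * y * (y * x * y * x)⁻¹) = y⁻¹ * (x * y) ^ 2 * y⁻¹⁻¹ := by
      simp only [sq, mul_inv_rev, inv_inv, hxi, mul_assoc, r1, r4, r6, h5, mul_inv_cancel_left]
    rw [this]
    exact isConj_conj _ _

theorem isPowBurnside_of_sorted {k l m n : ℕ} (hk : 2 ≤ k) (hkl : k ≤ l) (hlm : l ≤ m)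
    (hs : k * l * m ≤ l * m + k * m + k * l)
    (hnk : n.Coprime k) (hnl : n.Coprime l) (hnm : n.Coprime m) : IsPowBurnside k l m n G := by
  have hk3 : k ≤ 3 := by
    by_contra! h
    nlinarith [Nat.mul_le_mul_right (l * m) h, Nat.mul_le_mul_right m hkl,
      Nat.mul_le_mul hkl hlm, Nat.mul_pos (by omega : 0 < l) (by omega : 0 < m)]
  interval_cases k
  · have hl4 : l ≤ 4 := by
      by_contra! h
      nlinarith
    interval_cases l
    · exact isPowBurnside_dihedral (mod_two_of_coprime hnk)
    · have hm6 : m ≤ 6 := by omega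
      have h2 := mod_two_of_coprime hnk
      have h3 := mod_three_of_coprime hnl
      interval_cases m
      · rcases h3 with h3 | h3
        · exact isPowBurnside_of_mod_eq_one h2 h3 h3
        · exact isPowBurnside_of_dvd_succ (by omega) (by omega) (by omega)
      · exact isPowBurnside_octahedral hnk hnl
      · exact isPowBurnside_icosahedral hnk hnl hnm
      · rcases h3 with h3 | h3
        · exact isPowBurnside_of_mod_eq_one h2 h3 (by omega)
        · exact isPowBurnside_of_dvd_succ (by omega) (by omega) (by omega)
    · have hm4 : m = 4 := by omega
      subst hm4
      have h2 := mod_two_of_coprime hnk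
      rcases (by omega : n % 4 = 1 ∨ n % 4 = 3) with h | h
      · exact isPowBurnside_of_mod_eq_one h2 h h
      · exact isPowBurnside_of_dvd_succ (by omega) (by omega) (by omega)
  · have hl3 : l = 3 := by nlinarith
    subst hl3
    have hm3 : m = 3 := by omega
    subst hm3
    rcases mod_three_of_coprime hnk with h | h
    · exact isPowBurnside_of_mod_eq_one h h h
    · exact isPowBurnside_of_dvd_succ (by omega) (by omega) (by omega)

/-- Spherical and Euclidean triples: every unit exponent works in every group. -/
theorem isPowBurnside_of_nonhyperbolic {k l m n : ℕ} (hk : 2 ≤ k) (hl : 2 ≤ l) (hm : 2 ≤ m)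
    (hs : k * l * m ≤ l * m + k * m + k * l)
    (hnk : n.Coprime k) (hnl : n.Coprime l) (hnm : n.Coprime m) : IsPowBurnside k l m n G := by
  rcases le_total k l with h1 | h1 <;> rcases le_total l m with h2 | h2 <;>
    rcases le_total k m with h3 | h3
  · exact isPowBurnside_of_sorted hk h1 h2 hs hnk hnl hnm
  · exact isPowBurnside_of_sorted hk h1 h2 hs hnk hnl hnm
  · exact (isPowBurnside_of_sorted hk h3 h2 (by linarith [mul_right_comm k m l])
      hnk hnm hnl).swap.rotate
  · exact (isPowBurnside_of_sorted hm h3 h1 (by linarith [mul_comm (k * l) m, mul_assoc m k l])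
      hnm hnk hnl).rotate
  · exact (isPowBurnside_of_sorted hl h1 h3 (by linarith [mul_comm k l])
      hnl hnk hnm).swap
  · exact (isPowBurnside_of_sorted hl h2 h3
      (by linarith [mul_comm (l * m) k, mul_assoc k l m]) hnl hnm hnk).rotate.rotate
  · exact (isPowBurnside_of_sorted hm h2 h1
      (by linarith [mul_comm (m * l) k, mul_assoc k m l, mul_comm m l, mul_assoc k l m])
      hnm hnl hnk).swap.rotate.rotate
  · exact (isPowBurnside_of_sorted hm h2 h1
      (by linarith [mul_comm (m * l) k, mul_assoc k m l, mul_comm m l, mul_assoc k l m])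
      hnm hnl hnk).swap.rotate.rotate

end PowBurnside

/-! ### Arithmetic of angle triples. -/

theorem emod_pos_of_isCoprime {n m c : ℤ} (h : IsCoprime n m) (hc : 0 < c) (hcm : c < m) :
    0 < n * c % m := by
  refine lt_of_le_of_ne (Int.emod_nonneg _ (by omega)) fun h0 => ?_
  have := Int.le_of_dvd hc (h.symm.dvd_of_dvd_mul_left (Int.dvd_of_emod_eq_zero h0.symm))
  omega

theorem neg_mul_emod_of_isCoprime {n m c : ℤ} (h : IsCoprime n m) (hc : 0 < c) (hcm : c < m) :
    -n * c % m = m - n * c % m := by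
  have h1 := emod_pos_of_isCoprime h hc hcm
  have h2 := Int.emod_lt_of_pos (n * c) (by omega : 0 < m)
  rw [← Int.emod_eq_of_lt (a := m - n * c % m) (b := m) (by omega) (by omega)]
  refine Int.ModEq.eq ((Int.modEq_iff_dvd).2 ⟨1 + n * c / m, ?_⟩)
  have := Int.emod_add_mul_ediv (n * c) m
  linear_combination -this

/-- A unit modulo `m` that maps a proper initial segment `{1, …, t}` of the nonzero residues into
itself is trivial. -/
theorem emod_eq_one_of_preserves_segment {n m t : ℤ} (h : IsCoprime n m) (ht : 1 ≤ t)
    (htm : t ≤ m - 2) (hp : ∀ c, 1 ≤ c → c ≤ t → n * c % m ≤ t) : n % m = 1 := by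
  have hpos : ∀ c, 1 ≤ c → c ≤ t → 1 ≤ n * c % m := fun c h1 h2 =>
    emod_pos_of_isCoprime h (by omega) (by omega)
  have hmaps : Set.MapsTo (fun c => n * c % m) (Finset.Icc 1 t : Finset ℤ)
      (Finset.Icc 1 t : Finset ℤ) := by
    intro c hc
    simp only [Finset.coe_Icc, Set.mem_Icc] at hc ⊢
    exact ⟨hpos c hc.1 hc.2, hp c hc.1 hc.2⟩
  have hinj : Set.InjOn (fun c => n * c % m) (Finset.Icc 1 t : Finset ℤ) := by
    intro c hc d hd hcd
    simp only [Finset.coe_Icc, Set.mem_Icc] at hc hd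
    have hdvd : m ∣ c - d := by
      refine h.symm.dvd_of_dvd_mul_left ?_
      rw [mul_sub]
      exact Int.ModEq.dvd (Eq.symm hcd)
    have := Int.eq_zero_of_abs_lt_dvd hdvd (by rw [abs_lt]; omega)
    omega
  have hsurj := Finset.surjOn_of_injOn_of_card_le _ hmaps hinj le_rfl
  by_contra hne
  have h1 := hpos 1 le_rfl ht
  have h2 := hp 1 le_rfl ht
  rw [mul_one] at h1 h2
  -- The segment is permuted. If `n % m ≠ 1`, then `n % m - 1` is the image of some `i ≠ 1`, so `i -
  -- 1` lies in the segment but is sent to `m - 1 > t`.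
  obtain ⟨i, hi, hi'⟩ := hsurj (by
    simp only [Finset.coe_Icc, Set.mem_Icc]; omega :
      n % m - 1 ∈ ((Finset.Icc 1 t : Finset ℤ) : Set ℤ))
  simp only [Finset.coe_Icc, Set.mem_Icc] at hi hi'
  have hi1 : i ≠ 1 := by
    rintro rfl
    rw [mul_one] at hi'
    omega
  have h3 : n * (i - 1) % m = m - 1 := by
    rw [← Int.emod_eq_of_lt (a := m - 1) (b := m) (by omega) (by omega)]
    refine Int.ModEq.eq ((Int.modEq_iff_dvd).2 ⟨1 + n / m - n * i / m, ?_⟩)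
    have e1 := Int.emod_add_mul_ediv (n * i) m
    have e2 := Int.emod_add_mul_ediv n m
    linear_combination e1 - e2 - hi'
  have := hp (i - 1) (by omega) (by omega)
  omega

/-- Multiplication by `n` keeps every triple of angles `π a / k`, `π b / l`, `π c / m` of a
hyperbolic or Euclidean triangle in the region `sum ≤ π` or `sum ≥ 2π`. -/
def AngleStable (k l m n : ℤ) : Prop :=
  ∀ a b c : ℤ, 0 < a → a < k → 0 < b → b < l → 0 < c → c < m →
    (a / k + b / l + c / m : ℝ) ≤ 1 →
    (((n * a % k : ℤ) : ℝ) / k + ((n * b % l : ℤ) : ℝ) / l + ((n * c % m : ℤ) : ℝ) / m ≤ 1 ∨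
      2 ≤ ((n * a % k : ℤ) : ℝ) / k + ((n * b % l : ℤ) : ℝ) / l + ((n * c % m : ℤ) : ℝ) / m)

theorem AngleStable.swap {k l m n : ℤ} (h : AngleStable k l m n) : AngleStable l k m n := by
  intro a b c ha hak hb hbl hc hcm hs
  have := h b a c hb hbl ha hak hc hcm (by linarith)
  rcases this with h | h
  · left; linarith
  · right; linarith

theorem AngleStable.rotate {k l m n : ℤ} (h : AngleStable k l m n) : AngleStable l m k n := by
  intro a b c ha hak hb hbl hc hcm hs
  have := h c a b hc hcm ha hak hb hbl (by linarith)
  rcases this with h | h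
  · left; linarith
  · right; linarith

/-- Negation replaces each normalised angle `α` by `1 - α`, which exchanges the two alternatives. -/
theorem AngleStable.neg {k l m n : ℤ} (h : AngleStable k l m n) (hk : IsCoprime n k)
    (hl : IsCoprime n l) (hm : IsCoprime n m) : AngleStable k l m (-n) := by
  intro a b c ha hak hb hbl hc hcm hs
  rw [neg_mul_emod_of_isCoprime hk ha hak, neg_mul_emod_of_isCoprime hl hb hbl,
    neg_mul_emod_of_isCoprime hm hc hcm]
  have hk0 : (k : ℝ) ≠ 0 := by exact_mod_cast (by omega : k ≠ 0)
  have hl0 : (l : ℝ) ≠ 0 := by exact_mod_cast (by omega : l ≠ 0)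
  have hm0 : (m : ℝ) ≠ 0 := by exact_mod_cast (by omega : m ≠ 0)
  push_cast
  rw [sub_div, sub_div, sub_div, div_self hk0, div_self hl0, div_self hm0]
  rcases h a b c ha hak hb hbl hc hcm hs with h | h
  · right; linarith
  · left; linarith

/-- The `c` admissible with `a, b` form the segment from `1` to `t = ⌊m(1 - a/k - b/l)⌋`. `h1` makes
it nonempty and `h2` makes it proper; `h4` excludes the alternative `≥ 2`, and `h3` then keeps the
image of `c` in the segment. -/
theorem AngleStable.emod_eq_one {k l m n a b : ℤ} (h : AngleStable k l m n)
    (hm : 2 ≤ m) (hn : IsCoprime n m) (ha : 0 < a) (hak : a < k) (hb : 0 < b) (hbl : b < l)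
    (h1 : (a / k + b / l + 1 / m : ℝ) ≤ 1) (h2 : (1 / m : ℝ) < a / k + b / l)
    (h3 : (a / k + b / l : ℝ) ≤ ((n * a % k : ℤ) : ℝ) / k + ((n * b % l : ℤ) : ℝ) / l)
    (h4 : ((n * a % k : ℤ) : ℝ) / k + ((n * b % l : ℤ) : ℝ) / l < 1) : n % m = 1 := by
  have hm0 : (0 : ℝ) < m := by exact_mod_cast (by omega : 0 < m)
  have key : ∀ c : ℤ, c ≤ ⌊(m : ℝ) * (1 - (a / k + b / l))⌋ ↔
      (a / k + b / l + c / m : ℝ) ≤ 1 := by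
    intro c
    rw [Int.le_floor, ← div_le_iff₀' hm0]
    constructor <;> intro h <;> linarith
  refine emod_eq_one_of_preserves_segment (t := ⌊(m : ℝ) * (1 - (a / k + b / l))⌋) hn ?_ ?_ ?_
  · rw [key]; exact_mod_cast h1
  · by_contra! hc
    have := (key (m - 1)).1 (by omega)
    push_cast at this
    rw [sub_div, div_self hm0.ne'] at this
    linarith
  · intro c hc hct
    rw [key]
    have hc' := (key c).1 hct
    have hcm : c < m := by
      have h5 : (0 : ℝ) < 1 / m := by positivity
      have : (c : ℝ) / m < 1 := by linarith
      rw [div_lt_one hm0] at this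
      exact_mod_cast this
    have h6 : (((n * c % m : ℤ) : ℝ) / m) < 1 := by
      rw [div_lt_one hm0]
      exact_mod_cast Int.emod_lt_of_pos (n * c) (by omega)
    rcases h a b c ha hak hb hbl (by omega) hcm hc' with h | h <;> linarith

/-- Covers the case where `a = b = 1` gives no proper segment. As `n` fixes all residues modulo `k`,
a larger `a` can be used. -/
theorem AngleStable.emod_eq_one_of_emod {k l m n : ℤ} (h : AngleStable k l m n) (hk : 2 ≤ k)
    (hl : 2 ≤ l) (hm : 2 ≤ m) (hn : IsCoprime n m) (hnk : n % k = 1) (hnl : n % l = 1)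
    (hs : (1 / k + 1 / l : ℝ) ≤ 1 / m) : n % m = 1 := by
  have hk0 : (0 : ℝ) < k := by exact_mod_cast (by omega : 0 < k)
  have hl0 : (0 : ℝ) < l := by exact_mod_cast (by omega : 0 < l)
  have hm0 : (0 : ℝ) < m := by exact_mod_cast (by omega : 0 < m)
  rcases hm.eq_or_lt with rfl | hm3
  · have := emod_pos_of_isCoprime hn one_pos (by norm_num)
    omega
  have hm3' : (3 : ℝ) ≤ m := by exact_mod_cast hm3
  have hm1 : (1 / m : ℝ) ≤ 1 / 3 := one_div_le_one_div_of_le (by norm_num) hm3'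
  have hl1 : (0 : ℝ) < 1 / l := by positivity
  have hk1 : (0 : ℝ) < 1 / k := by positivity
  have hml : (0 : ℝ) ≤ 1 / m - 1 / l := by linarith
  -- The least `a` with `a/k + 1/l > 1/m`; for `m ≥ 3` the sum with `1/m` still stays below `1`.
  obtain ⟨a, ha⟩ : ∃ a : ℤ, a = ⌊(k : ℝ) * (1 / m - 1 / l)⌋ + 1 := ⟨_, rfl⟩
  have ha0 : 0 < a := by
    have : 0 ≤ ⌊(k : ℝ) * (1 / m - 1 / l)⌋ := Int.floor_nonneg.2 (by positivity)
    omega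
  have hlt : (1 / m - 1 / l : ℝ) < a / k := by
    rw [lt_div_iff₀' hk0, ha]
    push_cast
    exact Int.lt_floor_add_one _
  have hle : (a : ℝ) / k ≤ 1 / m - 1 / l + 1 / k := by
    rw [div_le_iff₀' hk0, ha, mul_add, mul_one_div_cancel hk0.ne']
    push_cast
    linarith [Int.floor_le ((k : ℝ) * (1 / m - 1 / l))]
  have hak : a < k := by
    have : (a : ℝ) / k < 1 := by linarith
    rw [div_lt_one hk0] at this
    exact_mod_cast this
  have e1 : n * a % k = a := by
    rw [Int.mul_emod, hnk, one_mul, Int.emod_emod_of_dvd _ (dvd_refl k)]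
    exact Int.emod_eq_of_lt ha0.le hak
  refine h.emod_eq_one (a := a) (b := 1) hm hn ha0 hak one_pos (by omega) ?_ ?_ ?_ ?_ <;>
    simp only [e1, hnl, mul_one, Int.cast_one] <;> linarith

/-- Hyperbolic triples: only the trivial units `±1` are angle stable. -/
theorem AngleStable.emod_eq_one_or_dvd {k l m n : ℤ} (h : AngleStable k l m n) (hk : 2 ≤ k)
    (hl : 2 ≤ l) (hm : 2 ≤ m) (hs : (1 / k + 1 / l + 1 / m : ℝ) < 1)
    (hnk : IsCoprime n k) (hnl : IsCoprime n l) (hnm : IsCoprime n m) :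
    (n % k = 1 ∧ n % l = 1 ∧ n % m = 1) ∨ (-n % k = 1 ∧ -n % l = 1 ∧ -n % m = 1) := by
  -- Up to replacing `n` by `-n`, the image of `(1,1,1)` has sum at most `1`. At most one of `1/k,
  -- 1/l, 1/m` can be at least the sum of the other two, so at least two of the residues are found
  -- with `a = b = 1`.
  have main : ∀ n : ℤ, AngleStable k l m n → IsCoprime n k → IsCoprime n l → IsCoprime n m →
      ((n * 1 % k : ℤ) : ℝ) / k + ((n * 1 % l : ℤ) : ℝ) / l + ((n * 1 % m : ℤ) : ℝ) / m ≤ 1 →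
      n % k = 1 ∧ n % l = 1 ∧ n % m = 1 := by
    intro n h hnk hnl hnm h1
    have hfrac : ∀ j : ℤ, 2 ≤ j → IsCoprime n j →
        (0 : ℝ) < 1 / j ∧ (1 / j : ℝ) ≤ ((n * 1 % j : ℤ) : ℝ) / j := by
      intro j hj hnj
      have hj0 : (0 : ℝ) < j := by exact_mod_cast (by omega : 0 < j)
      refine ⟨by positivity, ?_⟩
      gcongr
      exact_mod_cast emod_pos_of_isCoprime hnj one_pos (by omega)
    obtain ⟨k0, k1⟩ := hfrac k hk hnk
    obtain ⟨l0, l1⟩ := hfrac l hl hnl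
    obtain ⟨m0, m1⟩ := hfrac m hm hnm
    have hM : (1 / k + 1 / l : ℝ) ≤ 1 / m ∨ n % m = 1 := by
      refine or_iff_not_imp_left.2 fun hc => ?_
      refine h.emod_eq_one (a := 1) (b := 1) hm hnm one_pos (by omega) one_pos (by omega)
        ?_ ?_ ?_ ?_ <;> (try simp only [Int.cast_one]) <;> linarith
    have hK : (1 / l + 1 / m : ℝ) ≤ 1 / k ∨ n % k = 1 := by
      refine or_iff_not_imp_left.2 fun hc => ?_
      refine h.rotate.emod_eq_one (a := 1) (b := 1) hk hnk one_pos (by omega) one_pos (by omega)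
        ?_ ?_ ?_ ?_ <;> (try simp only [Int.cast_one]) <;> linarith
    have hL : (1 / m + 1 / k : ℝ) ≤ 1 / l ∨ n % l = 1 := by
      refine or_iff_not_imp_left.2 fun hc => ?_
      refine h.rotate.rotate.emod_eq_one (a := 1) (b := 1) hl hnl one_pos (by omega) one_pos
        (by omega) ?_ ?_ ?_ ?_ <;> (try simp only [Int.cast_one]) <;> linarith
    rcases hK with hK | hK
    · have hL := hL.resolve_left (by linarith)
      have hM := hM.resolve_left (by linarith)
      exact ⟨h.rotate.emod_eq_one_of_emod hl hm hk hnk hL hM hK, hL, hM⟩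
    rcases hL with hL | hL
    · have hM := hM.resolve_left (by linarith)
      exact ⟨hK, h.rotate.rotate.emod_eq_one_of_emod hm hk hl hnl hM hK hL, hM⟩
    rcases hM with hM | hM
    · exact ⟨hK, hL, h.emod_eq_one_of_emod hk hl hm hnm hK hL hM⟩
    · exact ⟨hK, hL, hM⟩
  rcases h 1 1 1 one_pos (by omega) one_pos (by omega) one_pos (by omega)
    (by simpa using hs.le) with h1 | h1
  · exact .inl (main n h hnk hnl hnm h1)
  · refine .inr (main (-n) (h.neg hnk hnl hnm) hnk.neg_left hnl.neg_left hnm.neg_left ?_)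
    rw [neg_mul_emod_of_isCoprime hnk one_pos (by omega),
      neg_mul_emod_of_isCoprime hnl one_pos (by omega),
      neg_mul_emod_of_isCoprime hnm one_pos (by omega)]
    have hk0 : (k : ℝ) ≠ 0 := by exact_mod_cast (by omega : k ≠ 0)
    have hl0 : (l : ℝ) ≠ 0 := by exact_mod_cast (by omega : l ≠ 0)
    have hm0 : (m : ℝ) ≠ 0 := by exact_mod_cast (by omega : m ≠ 0)
    push_cast at h1 ⊢
    rw [sub_div, sub_div, sub_div, div_self hk0, div_self hl0, div_self hm0]
    linarith

/-! ### Products of rotations in `SL₂(ℝ)` and `PSL₂(ℝ)`. -/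

section Rotations

open Real Matrix
open scoped MatrixGroups
/-- The rotation by `t`, as an element of `SL₂(ℝ)`. -/
noncomputable def rotSL (t : ℝ) : SL(2, ℝ) :=
  ⟨!![cos t, -sin t; sin t, cos t], by
    rw [det_fin_two_of]; linear_combination cos_sq_add_sin_sq t⟩

theorem rotSL_zero : rotSL 0 = 1 := by
  ext i j
  fin_cases i <;> fin_cases j <;> simp [rotSL]

theorem rotSL_add (s t : ℝ) : rotSL (s + t) = rotSL s * rotSL t := by
  ext i j
  rw [Matrix.SpecialLinearGroup.coe_mul]
  fin_cases i <;> fin_cases j <;>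
    simp [rotSL, cos_add, sin_add, mul_apply, Fin.sum_univ_two] <;> ring

theorem rotSL_neg (t : ℝ) : rotSL (-t) = (rotSL t)⁻¹ := by
  rw [eq_inv_iff_mul_eq_one, ← rotSL_add, neg_add_cancel, rotSL_zero]

theorem rotSL_nat_mul (n : ℕ) (t : ℝ) : rotSL (n * t) = rotSL t ^ n := by
  induction n with
  | zero => simp [rotSL_zero]
  | succ n ih => rw [pow_succ, ← ih, ← rotSL_add]; push_cast; ring_nf

theorem rotSL_pi : rotSL π = -1 := by
  ext i j
  fin_cases i <;> fin_cases j <;> simp [rotSL]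

theorem rotSL_pi_sub (t : ℝ) : rotSL (π - t) = -(rotSL t)⁻¹ := by
  rw [sub_eq_add_neg, rotSL_add, rotSL_pi, rotSL_neg, neg_one_mul]

theorem coe_conj_rotSL (g : SL(2, ℝ)) (t : ℝ) :
    ((g * rotSL t * g⁻¹ : SL(2, ℝ)) : Matrix (Fin 2) (Fin 2) ℝ) =
      !![cos t + sin t * (g 0 1 * g 1 1 + g 0 0 * g 1 0),
        -sin t * (g 0 0 ^ 2 + g 0 1 ^ 2);
        sin t * (g 1 0 ^ 2 + g 1 1 ^ 2),
        cos t - sin t * (g 0 1 * g 1 1 + g 0 0 * g 1 0)] := by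
  have hdet : g 0 0 * g 1 1 - g 0 1 * g 1 0 = 1 := by
    rw [← det_fin_two]; exact g.det_coe
  rw [Matrix.SpecialLinearGroup.coe_mul, Matrix.SpecialLinearGroup.coe_mul, Matrix.SpecialLinearGroup.coe_inv,
    adjugate_fin_two]
  ext i j
  fin_cases i <;> fin_cases j <;>
    simp only [rotSL, mul_apply, Fin.sum_univ_two, of_apply, cons_val', cons_val_zero,
      cons_val_one, Fin.zero_eta, Fin.mk_one, cons_val_fin_one]
  · linear_combination cos t * hdet
  · ring
  · ring
  · linear_combination cos t * hdet

theorem trace_conj_rotSL (g : SL(2, ℝ)) (t : ℝ) :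
    trace ((g * rotSL t * g⁻¹ : SL(2, ℝ)) : Matrix (Fin 2) (Fin 2) ℝ) = 2 * cos t := by
  rw [coe_conj_rotSL, trace_fin_two_of]
  ring

theorem trace_rotSL_mul_conj (g : SL(2, ℝ)) (s t : ℝ) :
    trace ((rotSL s * (g * rotSL t * g⁻¹) : SL(2, ℝ)) : Matrix (Fin 2) (Fin 2) ℝ) =
      2 * (cos s * cos t) - sin s * sin t *
        (g 0 0 ^ 2 + g 0 1 ^ 2 + g 1 0 ^ 2 + g 1 1 ^ 2) := by
  rw [Matrix.SpecialLinearGroup.coe_mul, coe_conj_rotSL, rotSL, trace_fin_two]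
  simp only [mul_apply, Fin.sum_univ_two, of_apply, cons_val', cons_val_zero, cons_val_one,
    cons_val_fin_one]
  ring

/-- With `p = g⁻¹h`, the trace depends on `p` only through its sum of squared entries, which is at
least `2` because `det p = 1`. -/
theorem trace_conj_mul_conj_le (g h : SL(2, ℝ)) {s t : ℝ}
    (hs : 0 ≤ sin s) (ht : 0 ≤ sin t) :
    trace (((g * rotSL s * g⁻¹) * (h * rotSL t * h⁻¹) : SL(2, ℝ)) : Matrix (Fin 2) (Fin 2) ℝ) ≤
      2 * cos (s + t) := by
  obtain ⟨p, hp⟩ : ∃ p, p = g⁻¹ * h := ⟨_, rfl⟩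
  have e : (g * rotSL s * g⁻¹) * (h * rotSL t * h⁻¹) =
      g * (rotSL s * (p * rotSL t * p⁻¹)) * g⁻¹ := by
    rw [hp]; group
  have hdet : p 0 0 * p 1 1 - p 0 1 * p 1 0 = 1 := by
    rw [← det_fin_two]; exact p.det_coe
  rw [e, Matrix.SpecialLinearGroup.coe_mul, trace_mul_comm, ← Matrix.SpecialLinearGroup.coe_mul,
    inv_mul_cancel_left, trace_rotSL_mul_conj, cos_add]
  have h2 : 2 ≤ p 0 0 ^ 2 + p 0 1 ^ 2 + p 1 0 ^ 2 + p 1 1 ^ 2 := by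
    nlinarith [sq_nonneg (p 0 0 - p 1 1), sq_nonneg (p 0 1 + p 1 0)]
  nlinarith [mul_le_mul_of_nonneg_left h2 (mul_nonneg hs ht)]

/-- If the conclusion fails, the two inequalities give `s + t ≤ u` and `t + u ≤ s`, contradicting `t
> 0`. -/
theorem two_pi_le_of_cos_le {s t u : ℝ} (hs : 0 < s) (hsp : s < π) (ht : 0 < t) (htp : t < π)
    (hu : 0 < u) (hup : u < π) (h1 : cos u ≤ cos (s + t)) (h2 : cos s ≤ cos (t + u)) :
    2 * π ≤ s + t + u := by
  have key : ∀ {v w : ℝ}, 0 < v → v < π → 0 < w → w < 2 * π → cos v ≤ cos w →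
      w ≤ v ∨ 2 * π ≤ v + w := by
    intro v w hv hvp hw hw2 h
    rcases le_total w π with hwp | hwp
    · left
      exact (strictAntiOn_cos.le_iff_ge ⟨hv.le, hvp.le⟩ ⟨hw.le, hwp⟩).1 h
    · right
      rw [← cos_two_pi_sub w] at h
      have := (strictAntiOn_cos.le_iff_ge ⟨hv.le, hvp.le⟩
        ⟨by linarith, by linarith⟩ ).1 h
      linarith
  rcases key hu hup (by linarith) (by linarith) h1 with h3 | h3
  · rcases key hs hsp (by linarith) (by linarith) h2 with h4 | h4 <;> linarith
  · linarith

theorem two_pi_le_of_conj_mul_conj_eq {g₁ g₂ g₃ : SL(2, ℝ)} {s t u : ℝ}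
    (hs : 0 < s) (hsp : s < π) (ht : 0 < t) (htp : t < π) (hu : 0 < u) (hup : u < π)
    (h : (g₁ * rotSL s * g₁⁻¹) * (g₂ * rotSL t * g₂⁻¹) = g₃ * rotSL (-u) * g₃⁻¹) :
    2 * π ≤ s + t + u := by
  have h1 := trace_conj_mul_conj_le g₁ g₂ (sin_pos_of_pos_of_lt_pi hs hsp).le
    (sin_pos_of_pos_of_lt_pi ht htp).le
  have h2 := trace_conj_mul_conj_le g₂ g₃ (sin_pos_of_pos_of_lt_pi ht htp).le
    (sin_pos_of_pos_of_lt_pi hu hup).le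
  have e : (g₂ * rotSL t * g₂⁻¹) * (g₃ * rotSL u * g₃⁻¹) = g₁ * rotSL (-s) * g₁⁻¹ := by
    have : g₃ * rotSL u * g₃⁻¹ = ((g₁ * rotSL s * g₁⁻¹) * (g₂ * rotSL t * g₂⁻¹))⁻¹ := by
      rw [h, rotSL_neg]; group
    rw [this, rotSL_neg]; group
  rw [h, trace_conj_rotSL, cos_neg] at h1
  rw [e, trace_conj_rotSL, cos_neg] at h2
  exact two_pi_le_of_cos_le hs hsp ht htp hu hup (by linarith) (by linarith)

/-- The trace fixes the angle up to sign, and the sign of the lower left entry decides between `t`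
and `-t`. The upper triangular conjugator is solved from `coe_conj_rotSL`. -/
theorem exists_eq_conj_rotSL {A : SL(2, ℝ)} {t : ℝ} (ht : 0 < sin t)
    (hA : 0 < A 1 0) (htr : A 0 0 + A 1 1 = 2 * cos t) :
    ∃ h : SL(2, ℝ), A = h * rotSL t * h⁻¹ := by
  have hdet : A 0 0 * A 1 1 - A 0 1 * A 1 0 = 1 := by
    rw [← det_fin_two]; exact A.det_coe
  obtain ⟨d, hd, hd2⟩ : ∃ d : ℝ, 0 < d ∧ sin t * d ^ 2 = A 1 0 :=
    ⟨√(A 1 0 / sin t), by positivity, by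
      rw [sq_sqrt (by positivity)]; field_simp⟩
  have hcs := cos_sq_add_sin_sq t
  obtain ⟨h, hh⟩ : ∃ h : SL(2, ℝ), (h : Matrix (Fin 2) (Fin 2) ℝ) =
      !![d⁻¹, (A 0 0 - cos t) / (sin t * d); 0, d] :=
    ⟨⟨_, by rw [det_fin_two_of, mul_zero, sub_zero, inv_mul_cancel₀ hd.ne']⟩, rfl⟩
  refine ⟨h, Matrix.SpecialLinearGroup.ext _ _ fun i j => ?_⟩
  rw [coe_conj_rotSL, hh]
  fin_cases i <;> fin_cases j <;>
    simp only [of_apply, cons_val', cons_val_zero, cons_val_one, Fin.zero_eta, Fin.mk_one,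
      cons_val_fin_one]
  · field_simp
    ring
  · have : A 0 1 * (sin t * d ^ 2) = -(sin t ^ 2 + (A 0 0 - cos t) ^ 2) := by
      rw [hd2]
      linear_combination -hdet + hcs + A 0 0 * htr
    field_simp
    linear_combination this
  · rw [← hd2]; ring
  · have : sin t * ((A 0 0 - cos t) / (sin t * d) * d + d⁻¹ * 0) = A 0 0 - cos t := by
      field_simp
      ring
    linear_combination htr + this

/-- Three positive angles with sum at most `π` are realised by a hyperbolic triangle. -/
theorem exists_rotSL_mul_conj_eq {s t u : ℝ} (hs : 0 < s) (ht : 0 < t) (hu : 0 < u)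
    (hsum : s + t + u ≤ π) :
    ∃ g h : SL(2, ℝ),
      rotSL s * (g * rotSL t * g⁻¹) = h * rotSL (π - u) * h⁻¹ := by
  have hss := sin_pos_of_pos_of_lt_pi hs (by linarith)
  have hst := sin_pos_of_pos_of_lt_pi ht (by linarith)
  have hcos : cos (π - u) ≤ cos (s + t) :=
    cos_le_cos_of_nonneg_of_le_pi (by linarith) (by linarith) (by linarith)
  -- Conjugation by the shear with entry `v` gives trace `2cos(s+t) - sin s sin t · v²`; `v` is
  -- chosen to make it `2cos(π-u)`.
  obtain ⟨v, hv, hv2⟩ : ∃ v : ℝ, 0 ≤ v ∧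
      sin s * sin t * v ^ 2 = 2 * (cos (s + t) - cos (π - u)) := by
    refine ⟨√(2 * (cos (s + t) - cos (π - u)) / (sin s * sin t)), sqrt_nonneg _, ?_⟩
    rw [sq_sqrt (div_nonneg (by linarith) (by positivity))]
    field_simp
  obtain ⟨g, hg⟩ : ∃ g : SL(2, ℝ), (g : Matrix (Fin 2) (Fin 2) ℝ) = !![1, v; 0, 1] :=
    ⟨⟨!![1, v; 0, 1], by simp⟩, rfl⟩
  have htr := trace_rotSL_mul_conj g s t
  obtain ⟨h, hh⟩ := exists_eq_conj_rotSL (A := rotSL s * (g * rotSL t * g⁻¹)) (t := π - u)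
    (sin_pos_of_pos_of_lt_pi (by linarith) (by linarith)) (by
      rw [Matrix.SpecialLinearGroup.coe_mul, coe_conj_rotSL, hg, rotSL]
      simp only [mul_apply, Fin.sum_univ_two, of_apply, cons_val', cons_val_zero, cons_val_one,
        cons_val_fin_one]
      have h1 : 0 < sin (s + t) := sin_pos_of_pos_of_lt_pi (by linarith) (by linarith)
      have h2 : 0 ≤ sin s * sin t * v := by positivity
      rw [sin_add] at h1
      linarith) (by
      rw [← trace_fin_two, htr, hg]
      simp only [of_apply, cons_val', cons_val_zero, cons_val_one, cons_val_fin_one]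
      rw [cos_add] at hv2
      linear_combination -hv2)
  exact ⟨g, h, hh⟩

/-- The rotation by `t` in `PSL₂(ℝ)`. -/
noncomputable def rotPSL (t : ℝ) : ProjectiveSpecialLinearGroup (Fin 2) ℝ :=
  QuotientGroup.mk (rotSL t)

theorem coe_neg_one_eq_one : ((-1 : SL(2, ℝ)) : ProjectiveSpecialLinearGroup (Fin 2) ℝ) = 1 := by
  rw [QuotientGroup.eq_one_iff, Matrix.SpecialLinearGroup.mem_center_iff]
  exact ⟨-1, by simp, by rw [map_neg, map_one]; simp⟩

theorem eq_or_eq_neg_of_coe_eq_coe {A B : SL(2, ℝ)}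
    (h : (A : ProjectiveSpecialLinearGroup (Fin 2) ℝ) = B) : A = B ∨ A = -B := by
  rw [eq_comm, QuotientGroup.eq, Matrix.SpecialLinearGroup.mem_center_iff] at h
  obtain ⟨r, hr, h⟩ := h
  rw [Fintype.card_fin, sq_eq_one_iff] at hr
  rcases hr with rfl | rfl
  · left
    have : B⁻¹ * A = 1 := Subtype.ext (by rw [← h]; simp)
    rw [← mul_one B, ← this, mul_inv_cancel_left]
  · right
    have : B⁻¹ * A = -1 := Subtype.ext (by rw [← h, map_neg, map_one]; simp)
    rw [← mul_neg_one, ← this, mul_inv_cancel_left]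

theorem rotPSL_add (s t : ℝ) : rotPSL (s + t) = rotPSL s * rotPSL t := by
  rw [rotPSL, rotSL_add]; rfl

theorem rotPSL_neg (t : ℝ) : rotPSL (-t) = (rotPSL t)⁻¹ := by
  rw [rotPSL, rotSL_neg]; rfl

theorem rotPSL_nat_mul (n : ℕ) (t : ℝ) : rotPSL (n * t) = rotPSL t ^ n := by
  rw [rotPSL, rotSL_nat_mul]; rfl

theorem rotPSL_int_mul_pi (j : ℤ) : rotPSL (j * π) = 1 := by
  have h : ∀ n : ℕ, rotPSL (n * π) = 1 := fun n => by
    rw [rotPSL_nat_mul, rotPSL, rotSL_pi, coe_neg_one_eq_one, one_pow]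
  obtain ⟨n, rfl | rfl⟩ := j.eq_nat_or_neg
  · exact_mod_cast h n
  · push_cast
    rw [neg_mul, rotPSL_neg, h n, inv_one]

theorem rotPSL_pi_sub (t : ℝ) : rotPSL (π - t) = rotPSL (-t) := by
  have := rotPSL_int_mul_pi 1
  rw [Int.cast_one, one_mul] at this
  rw [sub_eq_add_neg, rotPSL_add, this, one_mul]

theorem rotPSL_pow_eq_one (a : ℤ) {k : ℕ} (hk : k ≠ 0) : rotPSL (π * (a / k)) ^ k = 1 := by
  rw [← rotPSL_nat_mul, ← rotPSL_int_mul_pi a]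
  congr 1
  field_simp

theorem rotPSL_pow (a : ℤ) {k : ℕ} (hk : k ≠ 0) (n : ℕ) :
    rotPSL (π * (a / k)) ^ n = rotPSL (π * (((n * a % k : ℤ) : ℝ) / (k : ℤ))) := by
  rw [← rotPSL_nat_mul, ← mul_one (rotPSL (π * (((n * a % k : ℤ) : ℝ) / (k : ℤ)))),
    ← rotPSL_int_mul_pi (n * a / k), ← rotPSL_add]
  congr 1
  have h : (((n * a % k : ℤ) : ℝ)) + k * ((n * a / k : ℤ) : ℝ) = n * a := by
    exact_mod_cast Int.emod_add_mul_ediv (n * a) k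
  push_cast
  field_simp
  linear_combination -h

theorem exists_conj_of_isConj_rotPSL {x : ProjectiveSpecialLinearGroup (Fin 2) ℝ} {t : ℝ}
    (h : IsConj x (rotPSL t)) : ∃ g : SL(2, ℝ), x = (g * rotSL t * g⁻¹ : SL(2, ℝ)) := by
  obtain ⟨c, rfl⟩ := isConj_iff.1 h.symm
  obtain ⟨g, rfl⟩ := QuotientGroup.mk_surjective c
  exact ⟨g, rfl⟩

/-- Elliptic elements of `PSL₂(ℝ)` with product one have angles in the admissible region. -/
theorem angle_sum_le_or_le_of_isConj {x y : ProjectiveSpecialLinearGroup (Fin 2) ℝ} {s t u : ℝ}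
    (hs : 0 < s) (hsp : s < π) (ht : 0 < t) (htp : t < π) (hu : 0 < u) (hup : u < π)
    (hx : IsConj x (rotPSL s)) (hy : IsConj y (rotPSL t)) (hz : IsConj (x * y) (rotPSL (-u))) :
    s + t + u ≤ π ∨ 2 * π ≤ s + t + u := by
  obtain ⟨g₁, rfl⟩ := exists_conj_of_isConj_rotPSL hx
  obtain ⟨g₂, rfl⟩ := exists_conj_of_isConj_rotPSL hy
  obtain ⟨g₃, h⟩ := exists_conj_of_isConj_rotPSL hz
  rw [← QuotientGroup.mk_mul] at h
  rcases eq_or_eq_neg_of_coe_eq_coe h with h | h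
  · exact .inr (two_pi_le_of_conj_mul_conj_eq hs hsp ht htp hu hup h)
  · left
    -- When the lifts multiply with sign `-1`, inverting the relation absorbs the sign into the
    -- complementary angles, as `rotSL (π - t) = -(rotSL t)⁻¹`.
    have h' : (g₂ * rotSL (π - t) * g₂⁻¹) * (g₁ * rotSL (π - s) * g₁⁻¹) =
        g₃ * rotSL (-(π - u)) * g₃⁻¹ := by
      rw [rotSL_neg] at h
      have h2 := congrArg Inv.inv h
      rw [rotSL_neg, rotSL_pi_sub, rotSL_pi_sub, rotSL_pi_sub]
      simp only [mul_neg, neg_mul, neg_neg, _root_.mul_inv_rev, inv_inv, inv_neg, mul_assoc] at h2 ⊢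
      exact h2
    have := two_pi_le_of_conj_mul_conj_eq (s := π - t) (t := π - s) (u := π - u) (by linarith)
      (by linarith) (by linarith) (by linarith) (by linarith) (by linarith) h'
    linarith

/-- The rotations at the vertices of a triangle with angles `πa/k, πb/l, πc/m` are fed to the
property; the `n`-th powers have the angles reduced modulo `π`. -/
theorem angleStable_of_isPowBurnside {k l m n : ℕ} (hk : 2 ≤ k) (hl : 2 ≤ l) (hm : 2 ≤ m)
    (hnk : n.Coprime k) (hnl : n.Coprime l) (hnm : n.Coprime m)
    (h : IsPowBurnside k l m n (ProjectiveSpecialLinearGroup (Fin 2) ℝ)) :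
    AngleStable k l m n := by
  intro a b c ha hak hb hbl hc hcm hsum
  have hπ := pi_pos
  have hpos : ∀ {j : ℤ} {k : ℕ}, 0 < j → 2 ≤ k → 0 < π * ((j : ℝ) / (k : ℤ)) := by
    intro j k hj hk
    have h1 : (0 : ℝ) < j := by exact_mod_cast hj
    have h2 : (0 : ℝ) < (k : ℤ) := by exact_mod_cast (by omega : 0 < k)
    positivity
  have hlt : ∀ {j : ℤ} {k : ℕ}, j < k → 2 ≤ k → π * ((j : ℝ) / (k : ℤ)) < π := by
    intro j k hj hk
    have h2 : (0 : ℝ) < (k : ℤ) := by exact_mod_cast (by omega : 0 < k)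
    refine mul_lt_of_lt_one_right hπ ((div_lt_one h2).2 ?_)
    exact_mod_cast hj
  obtain ⟨g, w, hgw⟩ := exists_rotSL_mul_conj_eq (hpos ha hk) (hpos hb hl) (hpos hc hm)
    (by rw [← mul_add, ← mul_add]; exact mul_le_of_le_one_right hπ.le hsum)
  have hxy := congrArg (QuotientGroup.mk :
    SL(2, ℝ) → ProjectiveSpecialLinearGroup (Fin 2) ℝ) hgw
  simp only [QuotientGroup.mk_mul, QuotientGroup.mk_inv] at hxy
  change rotPSL _ * (g * rotPSL _ * (g : ProjectiveSpecialLinearGroup (Fin 2) ℝ)⁻¹) =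
    w * rotPSL _ * (w : ProjectiveSpecialLinearGroup (Fin 2) ℝ)⁻¹ at hxy
  simp only [Int.cast_natCast] at hxy
  rw [rotPSL_pi_sub, rotPSL_neg] at hxy
  obtain ⟨x', y', hx', hy', hz'⟩ := h (rotPSL (π * (a / k)))
    (g * rotPSL (π * (b / l)) * (g : ProjectiveSpecialLinearGroup (Fin 2) ℝ)⁻¹)
    (rotPSL_pow_eq_one a (by omega))
    (by rw [conj_pow, rotPSL_pow_eq_one b (by omega)]; simp)
    (by rw [hxy, conj_pow, inv_pow, rotPSL_pow_eq_one c (by omega)]; simp)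
  rw [rotPSL_pow a (by omega)] at hx'
  have hy' := hy'.trans ((isConj_conj _ _).pow n)
  rw [rotPSL_pow b (by omega)] at hy'
  rw [hxy] at hz'
  have hz' := hz'.trans ((isConj_conj _ _).pow n)
  rw [inv_pow, rotPSL_pow c (by omega), ← rotPSL_neg] at hz'
  have hk' : IsCoprime (n : ℤ) k := Nat.isCoprime_iff_coprime.2 hnk
  have hl' : IsCoprime (n : ℤ) l := Nat.isCoprime_iff_coprime.2 hnl
  have hm' : IsCoprime (n : ℤ) m := Nat.isCoprime_iff_coprime.2 hnm
  have := angle_sum_le_or_le_of_isConj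
    (hpos (emod_pos_of_isCoprime hk' ha hak) hk) (hlt (Int.emod_lt_of_pos _ (by omega)) hk)
    (hpos (emod_pos_of_isCoprime hl' hb hbl) hl) (hlt (Int.emod_lt_of_pos _ (by omega)) hl)
    (hpos (emod_pos_of_isCoprime hm' hc hcm) hm) (hlt (Int.emod_lt_of_pos _ (by omega)) hm)
    hx' hy' hz'
  rw [← mul_add, ← mul_add, mul_comm 2 π, mul_le_iff_le_one_right hπ,
    mul_le_mul_iff_right₀ hπ] at this
  exact this

/-! ### Assembly of the equivalence. -/

theorem isQuasiBurnside_iff_isPowBurnside {k l m : ℕ} (r : (ZMod ((k.lcm l).lcm m))ˣ)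
    (G : Type*) [Group G] :
    IsQuasiBurnside k l m r G ↔
      IsPowBurnside k l m (r : ZMod ((k.lcm l).lcm m)).val G := by
  constructor
  · intro h x y hx hy hz
    obtain ⟨x', y', _, rfl, h⟩ := h x y _ rfl hx hy hz
    exact ⟨x', y', h⟩
  · rintro h x y _ rfl hx hy hz
    obtain ⟨x', y', h⟩ := h x y hx hy hz
    exact ⟨x', y', _, rfl, h⟩

theorem IsPowBurnside.of_mulEquiv {k l m n : ℕ} {G H : Type*} [Group G] [Group H] (e : G ≃* H)
    (h : IsPowBurnside k l m n G) : IsPowBurnside k l m n H := by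
  intro x y hx hy hz
  obtain ⟨x', y', hx', hy', hz'⟩ := h (e.symm x) (e.symm y) (by rw [← map_pow, hx, map_one])
    (by rw [← map_pow, hy, map_one]) (by rw [← map_mul, ← map_pow, hz, map_one])
  refine ⟨e x', e y', ?_, ?_, ?_⟩
  · simpa using e.toMonoidHom.map_isConj hx'
  · simpa using e.toMonoidHom.map_isConj hy'
  · simpa using e.toMonoidHom.map_isConj hz'

theorem one_le_sum_inv_iff {k l m : ℕ} (hk : 2 ≤ k) (hl : 2 ≤ l) (hm : 2 ≤ m) :
    (1 : ℝ) / k + 1 / l + 1 / m ≥ 1 ↔ k * l * m ≤ l * m + k * m + k * l := by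
  have hk0 : (0 : ℝ) < k := by exact_mod_cast (by omega : 0 < k)
  have hl0 : (0 : ℝ) < l := by exact_mod_cast (by omega : 0 < l)
  have hm0 : (0 : ℝ) < m := by exact_mod_cast (by omega : 0 < m)
  rw [ge_iff_le, show (1 : ℝ) / k + 1 / l + 1 / m = (l * m + k * m + k * l) / (k * l * m) by
    field_simp, le_div_iff₀ (by positivity), one_mul]
  exact_mod_cast Iff.rfl

end Rotations

theorem theorem1p2 (k l m : ℕ) (hk : 2 ≤ k) (hl : 2 ≤ l) (hm : 2 ≤ m)
    (r : (ZMod ((k.lcm l).lcm m))ˣ) :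
    List.TFAE [
      ∀ (G : Type u) [Group G], IsQuasiBurnside k l m r G,
      IsQuasiBurnside k l m r (Matrix.ProjectiveSpecialLinearGroup (Fin 2) ℝ),
      (1 : ℝ) / k + 1 / l + 1 / m ≥ 1 ∨ r = 1 ∨ r = -1] := by
  simp only [isQuasiBurnside_iff_isPowBurnside]
  have dk : k ∣ (k.lcm l).lcm m := (Nat.dvd_lcm_left k l).trans (Nat.dvd_lcm_left _ m)
  have dl : l ∣ (k.lcm l).lcm m := (Nat.dvd_lcm_right k l).trans (Nat.dvd_lcm_left _ m)
  have dm : m ∣ (k.lcm l).lcm m := Nat.dvd_lcm_right _ m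
  have : NeZero ((k.lcm l).lcm m) :=
    ⟨Nat.lcm_ne_zero (Nat.lcm_ne_zero (by omega) (by omega)) (by omega)⟩
  have hr := ZMod.val_coe_unit_coprime r
  obtain ⟨n, hn⟩ : ∃ n, n = (r : ZMod ((k.lcm l).lcm m)).val := ⟨_, rfl⟩
  have hrn : (r : ZMod ((k.lcm l).lcm m)) = (n : ℤ) := by simp [hn]
  rw [← hn] at hr ⊢
  have hnk := hr.coprime_dvd_right dk
  have hnl := hr.coprime_dvd_right dl
  have hnm := hr.coprime_dvd_right dm
  -- `PSL₂(ℝ)` lives in universe `0`, so it is lifted to universe `u`.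
  tfae_have 1 → 2 := fun h => (h (ULift (Matrix.ProjectiveSpecialLinearGroup (Fin 2) ℝ))).of_mulEquiv
    MulEquiv.ulift
  tfae_have 2 → 3 := by
    intro h
    rw [or_iff_not_imp_left, ge_iff_le, not_le]
    intro hs
    have hdvd : ∀ j : ℤ, (k : ℤ) ∣ j → (l : ℤ) ∣ j → (m : ℤ) ∣ j →
        (j : ZMod ((k.lcm l).lcm m)) = 0 := by
      intro j h1 h2 h3
      rw [ZMod.intCast_zmod_eq_zero_iff_dvd]
      rw [Int.natCast_dvd] at *
      exact Nat.lcm_dvd (Nat.lcm_dvd h1 h2) h3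
    have hst := angleStable_of_isPowBurnside hk hl hm hnk hnl hnm h
    rcases hst.emod_eq_one_or_dvd (by exact_mod_cast hk) (by exact_mod_cast hl)
      (by exact_mod_cast hm) (by simpa only [Int.cast_natCast] using hs) (Nat.isCoprime_iff_coprime.2 hnk)
      (Nat.isCoprime_iff_coprime.2 hnl) (Nat.isCoprime_iff_coprime.2 hnm) with
      ⟨h1, h2, h3⟩ | ⟨h1, h2, h3⟩
    · left
      refine Units.ext ?_
      have := hdvd (n - 1) (Int.dvd_self_sub_of_emod_eq h1) (Int.dvd_self_sub_of_emod_eq h2)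
        (Int.dvd_self_sub_of_emod_eq h3)
      rw [hrn, Units.val_one]
      push_cast at this ⊢
      exact sub_eq_zero.1 this
    · right
      refine Units.ext ?_
      have := hdvd (-n - 1) (Int.dvd_self_sub_of_emod_eq h1) (Int.dvd_self_sub_of_emod_eq h2)
        (Int.dvd_self_sub_of_emod_eq h3)
      rw [hrn, Units.val_neg, Units.val_one]
      push_cast at this ⊢
      linear_combination -this
  tfae_have 3 → 1 := by
    rintro (h | rfl | rfl) G _
    · exact isPowBurnside_of_nonhyperbolic hk hl hm ((one_le_sum_inv_iff hk hl hm).1 h) hnk hnl hnm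
    · have h : n ≡ 1 [MOD (k.lcm l).lcm m] := by
        rw [← ZMod.natCast_eq_natCast_iff]
        simpa using hrn.symm
      exact isPowBurnside_of_mod_eq_one (h.of_dvd dk) (h.of_dvd dl) (h.of_dvd dm)
    · have h : (k.lcm l).lcm m ∣ n + 1 := by
        rw [← ZMod.natCast_eq_zero_iff]
        rw [Units.val_neg, Units.val_one] at hrn
        push_cast at hrn ⊢
        rw [← hrn, neg_add_cancel]
      exact isPowBurnside_of_dvd_succ (dk.trans h) (dl.trans h) (dm.trans h)
  tfae_finish
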